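/- Let $\Gamma=(\Gamma_0,\Gamma_1,\mu,\mathfrak o)$ be a Brauer configuration: $\Gamma_0$ is a finite set of vertices; $\Gamma_1$ is a finite collection of (labelled) finite multisets of vertices, called polygons; $\mu:\Gamma_0\to\mathbb Z_{>0}$ is a multiplicity function. Write $\mathrm{occ}(\alpha,V)$ for the number of times $\alpha$ occurs in $V$ and $\mathrm{val}(\alpha)=\sum_{V\in\Gamma_1}\mathrm{occ}(\alpha,V)$. The orientation $\mathfrak o$ chooses for every $\alpha$ a cyclic ordering $V_1<\dots<V_{\mathrm{val}(\alpha)}<V_1$ (the successor sequence at $\alpha$) of the list in which each polygon $V$ appears $\mathrm{occ}(\alpha,V)$ times. It is required that every vertex lies in some polygon, every polygon has at least two vertices (counted with repetition), and every polygon contains a vertex $\alpha$ with $\mathrm{val}(\alpha)\mu(\alpha)>1$. A vertex $\alpha$ is truncated if $\mathrm{val}(\alpha)\mu(\alpha)=1$. The quiver $\mathcal Q$ of $\Gamma$ has one vertex $v$ for each polygon $V$ and, for each nontruncated $\alpha$ and each position $i$ of its successor sequence, one arrow $a^{(\alpha)}_i$ from the vertex of $V_i$ to the vertex of $V_{i+1}$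 (indices modulo $\mathrm{val}(\alpha)$). The special $\alpha$-cycle at position $i$ is $C_i=a^{(\alpha)}_i a^{(\alpha)}_{i+1}\cdots a^{(\alpha)}_{i+\mathrm{val}(\alpha)-1}$; it is a special $\alpha$-cycle at $v$ if $V_i=V$. Paths are composed from left to right. Let $K$ be a field and $\Lambda=K\mathcal Q/I$ the Brauer configuration algebra of $\Gamma$, where $I$ is the two-sided ideal generated by: (1) all $C^{\mu(\alpha)}-D^{\mu(\beta)}$, where $C$ is a special $\alpha$-cycle at $v$ and $D$ a special $\beta$-cycle at the same $v$ ($\alpha,\beta$ nontruncated vertices of the corresponding polygon $V$); (2) all $C^{\mu(\alpha)}f(C)$, where $C$ is a special $\alpha$-cycle and $f(C)$ its first arrow; (3) all paths $ab$ of length two that are not a subpath of any special cycle, except when $a=b$ is the loop of a vertex $\alpha$ with $\mathrm{val}(\alpha)=1$ and $\mu(\alpha)>1$. Then for every polygon $V\in\Gamma_1$, with $v$ the associated vertex of $\mathcal Q$, the space $v\Lambda v$ is finite dimensional and $$\dim_K v\Lambda v = 2+\sum_{\alpha}\mathrm{occ}(\alpha,V)\bigl(\mathrm{occ}(\alpha,V)\,\mu(\alpha)-1\bigr),$$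 where $\alpha$ runs over the distinct vertices of $V$. Moreover, the following is a $K$-basis. For $\alpha\in V$ nontruncated, let $C_1,\dots,C_{t}$, $t=\mathrm{occ}(\alpha,V)$, be the special $\alpha$-cycles at $v$, in the cyclic order in which their starting positions occur in the successor sequence at $\alpha$, and let $q_l$ be the path of consecutive arrows $a^{(\alpha)}_i$ that starts where $C_l$ starts and runs to the next position of the successor sequence at which $V$ occurs (indices $l$ modulo $t$). Bars denote classes in $\Lambda$. Let - $\mathscr L_1$ be the set of all $\overline{C_l}^{\,j}$ with $\alpha\in V$, $\mu(\alpha)>1$, $1\le l\le t$, $1\le j\le\mu(\alpha)-1$; - $\mathscr L_2$ be the set of all $\overline{C_l}^{\,j}\,\overline{q_l}\,\overline{q_{l+1}}\cdots\overline{q_{l+k-1}}$ with $\alpha\in V$, $\mathrm{val}(\alpha)>1$, $\mu(\alpha)>1$, $t>1$, $1\le l\le t$, $0\le j\le\mu(\alpha)-1$, $1\le k\le t-1$; - $\mathscr L_3$ be the set of all $\overline{q_l}\,\overline{q_{l+1}}\cdots\overline{q_{l+k-1}}$ with $\alpha\in V$, $\mathrm{val}(\alpha)>1$, $\mu(\alpha)=1$,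 $t>1$, $1\le l\le t$, $1\le k\le t-1$. Then, for any special $\alpha$-cycle $C$ at $v$ (with $\alpha\in V$ nontruncated), the set $\mathscr L_1\cup\mathscr L_2\cup\mathscr L_3\cup\{\overline v,\ \overline C^{\,\mu(\alpha)}\}$ is a $K$-basis of $v\Lambda v$. -/

import Mathlib

/-! ### Path algebras of quivers with finitely many vertices -/

/-- A path of the quiver `Q`, together with its source and its target. -/
def AnyPath (Q : Type*) [Quiver Q] : Type _ := Σ a b : Q, Quiver.Path a b

/-- The path `p` is a subpath of the path `q`. -/
def Quiver.Path.IsSubpath {Q : Type*} [Quiver Q] {a b c d : Q}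
    (p : Quiver.Path a b) (q : Quiver.Path c d) : Prop :=
  ∃ (r : Quiver.Path c a) (s : Quiver.Path b d), q = (r.comp p).comp s

/-- The path algebra `K Q`: the vector space with basis the paths of `Q` (including the paths of
length zero). -/
def PathAlgebra (K Q : Type*) [Field K] [Quiver Q] : Type _ := AnyPath Q →₀ K

namespace PathAlgebra

noncomputable section

variable {K Q : Type*} [Field K] [Quiver Q]

instance : AddCommGroup (PathAlgebra K Q) := inferInstanceAs (AddCommGroup (AnyPath Q →₀ K))

instance : Module K (PathAlgebra K Q) := inferInstanceAs (Module K (AnyPath Q →₀ K))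

/-- The basis element of the path algebra given by a path. -/
def ofPath (K : Type*) {Q : Type*} [Field K] [Quiver Q] {a b : Q} (p : Quiver.Path a b) :
    PathAlgebra K Q :=
  Finsupp.single (⟨a, b, p⟩ : AnyPath Q) 1

open Classical in
/-- The product of two paths: first `p`, then `q` if the target of `p` is the source of `q`, and
zero otherwise. -/
def pathMul (K : Type*) {Q : Type*} [Field K] [Quiver Q] (p q : AnyPath Q) : PathAlgebra K Q :=
  if h : q.1 = p.2.1 then ofPath K (p.2.2.comp (q.2.2.cast h rfl)) else 0

/-- The bilinear extension of the product of paths. -/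
def mulBilin (K Q : Type*) [Field K] [Quiver Q] :
    PathAlgebra K Q →ₗ[K] PathAlgebra K Q →ₗ[K] PathAlgebra K Q :=
  Finsupp.linearCombination K fun p : AnyPath Q =>
    (Finsupp.linearCombination K fun q : AnyPath Q => pathMul K p q :
      (AnyPath Q →₀ K) →ₗ[K] PathAlgebra K Q)

instance : Mul (PathAlgebra K Q) := ⟨fun x y => mulBilin K Q x y⟩

/-- The identity of the path algebra: the sum of the paths of length zero. -/
instance [Fintype Q] : One (PathAlgebra K Q) :=
  ⟨∑ v : Q, ofPath K (Quiver.Path.nil : Quiver.Path v v)⟩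

theorem mul_def (x y : PathAlgebra K Q) : x * y = mulBilin K Q x y := rfl

theorem one_def [Fintype Q] :
    (1 : PathAlgebra K Q) = ∑ v : Q, ofPath K (Quiver.Path.nil : Quiver.Path v v) := rfl

theorem ofPath_mul_ofPath {a b c d : Q} (p : Quiver.Path a b) (q : Quiver.Path c d) :
    ofPath K p * ofPath K q = pathMul K ⟨a, b, p⟩ ⟨c, d, q⟩ := by
  rw [mul_def]
  unfold mulBilin ofPath
  erw [Finsupp.linearCombination_single, one_smul, Finsupp.linearCombination_single, one_smul]

theorem ofPath_mul_comp {a b c : Q} (p : Quiver.Path a b) (q : Quiver.Path b c) :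
    ofPath K p * ofPath K q = ofPath K (p.comp q) := by
  rw [ofPath_mul_ofPath]
  simp [pathMul]

theorem ofPath_mul_of_ne {a b c d : Q} (p : Quiver.Path a b) (q : Quiver.Path c d) (h : c ≠ b) :
    ofPath K p * ofPath K q = 0 := by
  rw [ofPath_mul_ofPath]
  simp [pathMul, h]

/-- Two linear maps on the path algebra agree if they agree on the paths. -/
theorem linearMap_ext {M : Type*} [AddCommMonoid M] [Module K M] {f g : PathAlgebra K Q →ₗ[K] M}
    (h : ∀ (a b : Q) (p : Quiver.Path a b), f (ofPath K p) = g (ofPath K p)) : f = g :=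
  Finsupp.lhom_ext' fun p => LinearMap.ext_ring (h p.1 p.2.1 p.2.2)

theorem ofPath_mul_assoc {a b c d e f : Q} (p : Quiver.Path a b) (q : Quiver.Path c d)
    (r : Quiver.Path e f) :
    ofPath K p * ofPath K q * ofPath K r = ofPath K p * (ofPath K q * ofPath K r) := by
  have z₁ : ∀ x : PathAlgebra K Q, 0 * x = 0 := fun x => by simp [mul_def]
  have z₂ : ∀ x : PathAlgebra K Q, x * 0 = 0 := fun x => by simp [mul_def]
  by_cases h₁ : c = b
  · subst h₁
    by_cases h₂ : e = d
    · subst h₂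
      simp [ofPath_mul_comp]
    · rw [ofPath_mul_comp, ofPath_mul_of_ne _ _ h₂, ofPath_mul_of_ne _ _ h₂, z₂]
  · by_cases h₂ : e = d
    · subst h₂
      rw [ofPath_mul_comp, ofPath_mul_of_ne _ _ h₁, ofPath_mul_of_ne _ _ h₁, z₁]
    · rw [ofPath_mul_of_ne _ _ h₁, ofPath_mul_of_ne _ _ h₂, z₁, z₂]

protected theorem mul_assoc (x y z : PathAlgebra K Q) : x * y * z = x * (y * z) := by
  have h₁ : ∀ {a b c d : Q} (p : Quiver.Path a b) (q : Quiver.Path c d) (z : PathAlgebra K Q),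
      ofPath K p * ofPath K q * z = ofPath K p * (ofPath K q * z) := fun p q =>
    LinearMap.congr_fun (f := mulBilin K Q (ofPath K p * ofPath K q))
      (g := mulBilin K Q (ofPath K p) ∘ₗ mulBilin K Q (ofPath K q))
      (linearMap_ext fun _ _ r => ofPath_mul_assoc p q r)
  have h₂ : ∀ {a b : Q} (p : Quiver.Path a b) (z y : PathAlgebra K Q),
      ofPath K p * y * z = ofPath K p * (y * z) := fun p z =>
    LinearMap.congr_fun (f := (mulBilin K Q).flip z ∘ₗ mulBilin K Q (ofPath K p))
      (g := mulBilin K Q (ofPath K p) ∘ₗ (mulBilin K Q).flip z)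
      (linearMap_ext fun _ _ q => h₁ p q z)
  exact LinearMap.congr_fun (f := (mulBilin K Q).flip z ∘ₗ (mulBilin K Q).flip y)
    (g := (mulBilin K Q).flip (y * z)) (linearMap_ext fun _ _ p => h₂ p z y) x

protected theorem one_mul [Fintype Q] (x : PathAlgebra K Q) : 1 * x = x := by
  have h : mulBilin K Q 1 = LinearMap.id := by
    refine linearMap_ext fun a b p => ?_
    rw [one_def, map_sum, LinearMap.sum_apply, LinearMap.id_apply,
      Finset.sum_eq_single a]
    · rw [← mul_def, ofPath_mul_comp, Quiver.Path.nil_comp]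
    · intro v _ hv
      rw [← mul_def, ofPath_mul_of_ne _ _ hv.symm]
    · simp
  exact LinearMap.congr_fun h x

protected theorem mul_one [Fintype Q] (x : PathAlgebra K Q) : x * 1 = x := by
  have h : (mulBilin K Q).flip 1 = LinearMap.id := by
    refine linearMap_ext fun a b p => ?_
    rw [LinearMap.flip_apply, one_def, map_sum, LinearMap.id_apply, Finset.sum_eq_single b]
    · rw [← mul_def, ofPath_mul_comp, Quiver.Path.comp_nil]
    · intro v _ hv
      rw [← mul_def, ofPath_mul_of_ne _ _ hv]
    · simp
  exact LinearMap.congr_fun h x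

instance [Fintype Q] : Ring (PathAlgebra K Q) where
  __ := (inferInstance : AddCommGroup (PathAlgebra K Q))
  mul_assoc := PathAlgebra.mul_assoc
  one_mul := PathAlgebra.one_mul
  mul_one := PathAlgebra.mul_one
  zero_mul x := by simp [mul_def]
  mul_zero x := by simp [mul_def]
  left_distrib x y z := by simp [mul_def]
  right_distrib x y z := by simp [mul_def]

instance [Fintype Q] : Algebra K (PathAlgebra K Q) :=
  Algebra.ofModule (fun r x y => by simp [mul_def]) (fun r x y => by simp [mul_def])

end

end PathAlgebra

/-! ### Brauer configurations -/

open Classical in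
/-- A Brauer configuration with vertex set `Γ₀` and (labels of) polygons `Γ₁`. The orientation is
given, for each vertex `α`, by a list of the polygons in which `α` occurs, each of them listed as
often as `α` occurs in it; the list is read cyclically. -/
structure BrauerConfiguration (Γ₀ Γ₁ : Type*) [Fintype Γ₁] where
  /-- the multiset of vertices of a polygon -/
  polygon : Γ₁ → Multiset Γ₀
  /-- the multiplicity function -/
  mult : Γ₀ → ℕ
  mult_pos : ∀ α, 0 < mult α
  /-- the orientation: the successor sequence at a vertex -/
  succSeq : Γ₀ → List Γ₁
  count_succSeq : ∀ α V, (succSeq α).count V = (polygon V).count α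
  exists_mem_polygon : ∀ α, ∃ V, α ∈ polygon V
  two_le_card : ∀ V, 2 ≤ Multiset.card (polygon V)
  exists_nontruncated : ∀ V, ∃ α ∈ polygon V, 1 < (∑ W, (polygon W).count α) * mult α

namespace BrauerConfiguration

noncomputable section

variable {Γ₀ Γ₁ : Type*} [Fintype Γ₁] (Γ : BrauerConfiguration Γ₀ Γ₁)

open Classical in
/-- The number of times `α` occurs as a vertex in the polygon `V`. -/
def occ (α : Γ₀) (V : Γ₁) : ℕ := (Γ.polygon V).count α

/-- The valency of a vertex. -/
def val (α : Γ₀) : ℕ := ∑ V, Γ.occ α V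

/-- A vertex `α` is truncated if `μ(α) val(α) = 1`. -/
def IsTruncated (α : Γ₀) : Prop := Γ.mult α * Γ.val α = 1

theorem length_succSeq (α : Γ₀) : (Γ.succSeq α).length = Γ.val α := by
  classical
  rw [val, ← Multiset.coe_card, ← Multiset.sum_count_eq_card (s := Finset.univ) (by simp)]
  refine Finset.sum_congr rfl fun V _ => ?_
  rw [Multiset.coe_count, occ]
  convert Γ.count_succSeq α V

theorem val_pos (α : Γ₀) : 0 < Γ.val α := by
  classical
  obtain ⟨V, hV⟩ := Γ.exists_mem_polygon α
  refine lt_of_lt_of_le ?_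
    (Finset.single_le_sum (f := fun V => Γ.occ α V) (fun _ _ => Nat.zero_le _) (Finset.mem_univ V))
  simpa [occ, Multiset.count_pos] using hV

/-- The polygon at position `i` of the successor sequence at `α`; positions are taken modulo
`val(α)` and start from `0`. -/
def polyAt (α : Γ₀) (i : ℕ) : Γ₁ :=
  (Γ.succSeq α)[i % Γ.val α]'(by
    rw [Γ.length_succSeq]
    exact Nat.mod_lt _ (Γ.val_pos α))

theorem polyAt_add_val (α : Γ₀) (i : ℕ) : Γ.polyAt α (i + Γ.val α) = Γ.polyAt α i := by
  simp [polyAt]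

/-! ### The quiver of a Brauer configuration -/

/-- The vertices of the quiver of `Γ` are the polygons of `Γ`. -/
def QVertex (_ : BrauerConfiguration Γ₀ Γ₁) : Type _ := Γ₁

instance : Fintype Γ.QVertex := inferInstanceAs (Fintype Γ₁)

/-- The vertex of the quiver that is associated to a polygon. -/
def toQVertex (V : Γ₁) : Γ.QVertex := V

/-- The arrows of the quiver: one for each nontruncated vertex `α` and each position in the
successor sequence at `α`. -/
structure Arrow where
  vertex : Γ₀
  nontruncated : ¬ Γ.IsTruncated vertex
  pos : Fin (Γ.val vertex)

/-- The quiver of `Γ`: the arrow at position `i` in the successor sequence at `α` runs from the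
polygon at this position to its successor. -/
instance : Quiver Γ.QVertex where
  Hom v w := {a : Γ.Arrow // Γ.toQVertex (Γ.polyAt a.vertex a.pos) = v ∧
    Γ.toQVertex (Γ.polyAt a.vertex (a.pos + 1)) = w}

/-- The arrow at position `i` (modulo `val(α)`) in the successor sequence at `α`. -/
def arrowAt (α : Γ₀) (h : ¬ Γ.IsTruncated α) (i : ℕ) :
    Γ.toQVertex (Γ.polyAt α i) ⟶ Γ.toQVertex (Γ.polyAt α (i + 1)) :=
  ⟨⟨α, h, ⟨i % Γ.val α, Nat.mod_lt _ (Γ.val_pos α)⟩⟩, by simp [polyAt], by simp [polyAt]⟩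

/-- The path of length `k` that starts at position `i` of the successor sequence at `α` and follows
this sequence. -/
def walk (α : Γ₀) (h : ¬ Γ.IsTruncated α) (i : ℕ) :
    (k : ℕ) → Quiver.Path (Γ.toQVertex (Γ.polyAt α i)) (Γ.toQVertex (Γ.polyAt α (i + k)))
  | 0 => Quiver.Path.nil
  | k + 1 => (walk α h i k).cons (Γ.arrowAt α h (i + k))

/-- The special `α`-cycle that starts at position `i` of the successor sequence at `α`. -/
def specialCycle (α : Γ₀) (h : ¬ Γ.IsTruncated α) (i : ℕ) :
    Quiver.Path (Γ.toQVertex (Γ.polyAt α i)) (Γ.toQVertex (Γ.polyAt α i)) :=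
  (Γ.walk α h i (Γ.val α)).cast rfl (congrArg Γ.toQVertex (Γ.polyAt_add_val α i))

/-! ### The Brauer configuration algebra -/

variable (K : Type*) [Field K]

/-- The special `α`-cycle at position `i`, as an element of the path algebra. -/
def specialElt (α : Γ₀) (h : ¬ Γ.IsTruncated α) (i : ℕ) : PathAlgebra K Γ.QVertex :=
  PathAlgebra.ofPath K (Γ.specialCycle α h i)

/-- Relations of type one: `C ^ μ(α) - D ^ μ(β)` for special cycles `C`, `D` at the same polygon. -/
def relationsOne : Set (PathAlgebra K Γ.QVertex) :=
  {x | ∃ (α β : Γ₀) (hα : ¬ Γ.IsTruncated α) (hβ : ¬ Γ.IsTruncated β) (i j : ℕ),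
    Γ.polyAt α i = Γ.polyAt β j ∧
    x = Γ.specialElt K α hα i ^ Γ.mult α - Γ.specialElt K β hβ j ^ Γ.mult β}

/-- Relations of type two: `C ^ μ(α) f(C)`, where `f(C)` is the first arrow of `C`. -/
def relationsTwo : Set (PathAlgebra K Γ.QVertex) :=
  {x | ∃ (α : Γ₀) (hα : ¬ Γ.IsTruncated α) (i : ℕ),
    x = Γ.specialElt K α hα i ^ Γ.mult α * PathAlgebra.ofPath K (Γ.arrowAt α hα i).toPath}

/-- Relations of type three: the paths `ab` of length two that are not a subpath of any special
cycle, except the squares of the loops of vertices of valency one. -/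
def relationsThree : Set (PathAlgebra K Γ.QVertex) :=
  {x | ∃ (u v w : Γ.QVertex) (a : u ⟶ v) (b : v ⟶ w),
    (∀ (α : Γ₀) (hα : ¬ Γ.IsTruncated α) (i : ℕ),
      ¬ (a.toPath.comp b.toPath).IsSubpath (Γ.specialCycle α hα i)) ∧
    ¬ (a.1 = b.1 ∧ Γ.val a.1.vertex = 1) ∧
    x = PathAlgebra.ofPath K (a.toPath.comp b.toPath)}

/-- The ideal generated by the relations. -/
def relationIdeal : TwoSidedIdeal (PathAlgebra K Γ.QVertex) :=
  TwoSidedIdeal.span (Γ.relationsOne K ∪ Γ.relationsTwo K ∪ Γ.relationsThree K)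

/-- The Brauer configuration algebra of `Γ` over `K`. -/
abbrev Alg : Type _ := (Γ.relationIdeal K).ringCon.Quotient

/-- The canonical surjection from the path algebra to the Brauer configuration algebra. -/
def proj : PathAlgebra K Γ.QVertex →+* Γ.Alg K := (Γ.relationIdeal K).ringCon.mk'

/-- The idempotent of the algebra given by the quiver vertex of the polygon `V`. -/
def idem (V : Γ₁) : Γ.Alg K :=
  Γ.proj K (PathAlgebra.ofPath K (Quiver.Path.nil : Quiver.Path (Γ.toQVertex V) (Γ.toQVertex V)))

/-- The subspace `vΛv = {v x v | x ∈ Λ}`, where `v` is the quiver vertex of the polygon `V`. -/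
def corner (V : Γ₁) : Submodule K (Γ.Alg K) :=
  LinearMap.range
    (LinearMap.mulLeft K (Γ.idem K V) ∘ₗ LinearMap.mulRight K (Γ.idem K V))

/-! ### Powers of special cycles and products of non-special cycles -/

/-- The number of steps from position `i` of the successor sequence at `α` to the next occurrence of
the same polygon. -/
def gap (α : Γ₀) (i : ℕ) : ℕ := sInf {d | 0 < d ∧ Γ.polyAt α (i + d) = Γ.polyAt α i}

/-- The position of the next occurrence of the polygon at position `i`. -/
def next (α : Γ₀) (i : ℕ) : ℕ := i + Γ.gap α i

/-- The image in the algebra of the special `α`-cycle at position `i`. -/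
def specialBar (α : Γ₀) (h : ¬ Γ.IsTruncated α) (i : ℕ) : Γ.Alg K :=
  Γ.proj K (Γ.specialElt K α h i)

/-- The image in the algebra of the non-special `α`-cycle `q` at position `i`: the path from position
`i` to the next occurrence of the same polygon. -/
def nonSpecialBar (α : Γ₀) (h : ¬ Γ.IsTruncated α) (i : ℕ) : Γ.Alg K :=
  Γ.proj K (PathAlgebra.ofPath K (Γ.walk α h i (Γ.gap α i)))

/-- The product of the `k` consecutive non-special `α`-cycles that starts with the one at position
`i`. -/
def nonSpecialProd (α : Γ₀) (h : ¬ Γ.IsTruncated α) (i k : ℕ) : Γ.Alg K :=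
  ((List.range k).map fun r => Γ.nonSpecialBar K α h ((Γ.next α)^[r] i)).prod

/-- The powers `C ^ j`, `1 ≤ j ≤ μ(α) - 1`, of the special `α`-cycles at `V`, for the vertices `α` of
`V` with `μ(α) > 1`. -/
def basisOne (V : Γ₁) : Set (Γ.Alg K) :=
  {x | ∃ (α : Γ₀) (h : ¬ Γ.IsTruncated α) (i j : ℕ), 1 < Γ.mult α ∧
    Γ.polyAt α i = V ∧ 1 ≤ j ∧ j ≤ Γ.mult α - 1 ∧ x = Γ.specialBar K α h i ^ j}

/-- The products `C_l ^ j q_l ⋯ q_{l+k-1}`, `0 ≤ j ≤ μ(α) - 1`, `1 ≤ k ≤ occ(α, V) - 1`, for the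
vertices `α` of `V` with `val(α) > 1`, `μ(α) > 1` and `occ(α, V) > 1`. -/
def basisTwo (V : Γ₁) : Set (Γ.Alg K) :=
  {x | ∃ (α : Γ₀) (h : ¬ Γ.IsTruncated α) (i j k : ℕ), 1 < Γ.val α ∧ 1 < Γ.mult α ∧
    1 < Γ.occ α V ∧ Γ.polyAt α i = V ∧ j ≤ Γ.mult α - 1 ∧ 1 ≤ k ∧ k ≤ Γ.occ α V - 1 ∧
    x = Γ.specialBar K α h i ^ j * Γ.nonSpecialProd K α h i k}

/-- The products `q_l ⋯ q_{l+k-1}`, `1 ≤ k ≤ occ(β, V) - 1`, for the vertices `β` of `V` with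
`val(β) > 1`, `μ(β) = 1` and `occ(β, V) > 1`. -/
def basisThree (V : Γ₁) : Set (Γ.Alg K) :=
  {x | ∃ (β : Γ₀) (h : ¬ Γ.IsTruncated β) (i k : ℕ), 1 < Γ.val β ∧ Γ.mult β = 1 ∧
    1 < Γ.occ β V ∧ Γ.polyAt β i = V ∧ 1 ≤ k ∧ k ≤ Γ.occ β V - 1 ∧
    x = Γ.nonSpecialProd K β h i k}

/-- The three families above together with the idempotent of `V` and an element `c`. -/
def basisSet (V : Γ₁) (c : Γ.Alg K) : Set (Γ.Alg K) :=
  Γ.basisOne K V ∪ Γ.basisTwo K V ∪ Γ.basisThree K V ∪ {Γ.idem K V, c}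

end

end BrauerConfiguration

/-! ### Paths as lists of arrows -/

namespace PathAlgebra

noncomputable section

variable {K Q : Type*} [Field K] [Quiver Q]

/-! A path is determined by its source and its list of arrows, so everything reduces to words in
arrows. Modulo the relations, a path survives only if each arrow is the successor of the one before
(`proj_eq_zero_of_not_isSuccChain`), that is, if it is trivial or follows the successor sequence of
a single vertex α, and only if its length is at most μ(α)·val(α) (`walkBar_eq_zero`). All walks of
exactly this length that start at the same polygon become equal (`walkBar_mult_eq`). So vΛv is
spanned by the idempotent, one socle element, and the closed walks at V of length strictly between 0
and μ(α)·val(α).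

For independence no rewriting argument is needed. The linear map `normalForm` sends a path to a
formal symbol for its expected class, or to zero. It kills every product x r y with r a generator,
hence the whole ideal (`normalForm_of_mem`). The lifts of the proposed basis elements go to distinct
symbols, so their classes are independent (`linearIndependent_proj`, `normalForm_basisLift`).

The three families of the statement are a rewriting of these closed walks: dividing the length by
val(α) gives the power of the special cycle, and counting the visits to V in the remainder gives the
number of factors q (`mem_basis_iff`). For the dimension, each nontruncated α has occ(α,V) starting
positions, and each of these has occ(α,V)μ(α) − 1 admissible lengths (`card_lengths`). -/

@[elab_as_elim]
theorem induction_on_paths {motive : PathAlgebra K Q → Prop} (x : PathAlgebra K Q)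
    (zero : motive 0) (add : ∀ x y, motive x → motive y → motive (x + y))
    (smul : ∀ (c : K) {a b : Q} (p : Quiver.Path a b), motive (c • ofPath K p)) : motive x := by
  refine Finsupp.induction_linear (motive := motive) x zero add fun p c => ?_
  have h : (Finsupp.single p c : AnyPath Q →₀ K) = c • Finsupp.single p 1 := by simp
  rw [h]
  exact smul c p.2.2

end

end PathAlgebra

namespace BrauerConfiguration

noncomputable section

variable {Γ₀ Γ₁ : Type*} [Fintype Γ₁] (Γ : BrauerConfiguration Γ₀ Γ₁)

variable {Γ} in
/-- The list of the arrows of a path. -/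
def arrows {v : Γ.QVertex} : {w : Γ.QVertex} → Quiver.Path v w → List Γ.Arrow
  | _, Quiver.Path.nil => []
  | _, Quiver.Path.cons p e => arrows p ++ [e.1]

@[simp]
theorem arrows_nil (v : Γ.QVertex) : arrows (Quiver.Path.nil : Quiver.Path v v) = [] := rfl

@[simp]
theorem arrows_cons {u v w : Γ.QVertex} (p : Quiver.Path u v) (e : v ⟶ w) :
    arrows (p.cons e) = arrows p ++ [e.1] := rfl

@[simp]
theorem arrows_toPath {v w : Γ.QVertex} (e : v ⟶ w) : arrows e.toPath = [e.1] := rfl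

@[simp]
theorem arrows_comp {u v w : Γ.QVertex} (p : Quiver.Path u v) (q : Quiver.Path v w) :
    arrows (p.comp q) = arrows p ++ arrows q := by
  induction q with
  | nil => simp
  | cons q e ih => simp [ih]

@[simp]
theorem arrows_cast {u v u' v' : Γ.QVertex} (hu : u = u') (hv : v = v') (p : Quiver.Path u v) :
    arrows (p.cast hu hv) = arrows p := by
  subst hu hv
  rfl

/-- Each arrow determines its own target, so the source and the arrows fix the path. The target is
part of the conclusion, so that paths whose endpoints are not known to agree can be compared. -/
theorem anyPath_ext {a b d : Γ.QVertex} (p : Quiver.Path a b) (q : Quiver.Path a d)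
    (h : arrows p = arrows q) : (⟨b, p⟩ : Σ c, Quiver.Path a c) = ⟨d, q⟩ := by
  induction p generalizing d with
  | nil =>
    cases q with
    | nil => rfl
    | cons q e => simp at h
  | cons p e ih =>
    cases q with
    | nil => simp at h
    | cons q e' =>
      rw [arrows_cons, arrows_cons] at h
      obtain ⟨h₁, h₂⟩ := List.append_inj' h rfl
      cases ih q h₁
      obtain ⟨e, he₁, he₂⟩ := e
      obtain ⟨e', he'₁, he'₂⟩ := e'
      simp only [List.cons.injEq, and_true] at h₂
      subst h₂ he₂ he'₂
      rfl

theorem path_ext {a b : Γ.QVertex} {p q : Quiver.Path a b} (h : arrows p = arrows q) : p = q := by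
  simpa using Γ.anyPath_ext p q h

theorem ofPath_congr (K : Type*) [Field K] {a b c d : Γ.QVertex} (p : Quiver.Path a b)
    (q : Quiver.Path c d) (hac : a = c) (h : arrows p = arrows q) :
    PathAlgebra.ofPath K p = PathAlgebra.ofPath K q := by
  subst hac
  cases Γ.anyPath_ext p q h
  rfl

theorem target_eq {a b c d : Γ.QVertex} (p : Quiver.Path a b)
    (q : Quiver.Path c d) (hac : a = c) (h : arrows p = arrows q) : b = d := by
  subst hac
  cases Γ.anyPath_ext p q h
  rfl

theorem exists_split {v w : Γ.QVertex} (p : Quiver.Path v w) (l₁ l₂ : List Γ.Arrow)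
    (h : arrows p = l₁ ++ l₂) :
    ∃ (u : Γ.QVertex) (p₁ : Quiver.Path v u) (p₂ : Quiver.Path u w),
      p = p₁.comp p₂ ∧ arrows p₁ = l₁ ∧ arrows p₂ = l₂ := by
  induction p generalizing l₂ with
  | nil =>
    obtain ⟨rfl, rfl⟩ : l₁ = [] ∧ l₂ = [] := by simpa using h
    exact ⟨v, .nil, .nil, rfl, rfl, rfl⟩
  | cons p e ih =>
    rcases List.eq_nil_or_concat' l₂ with rfl | ⟨l, x, rfl⟩
    · exact ⟨_, p.cons e, .nil, rfl, by simpa using h, rfl⟩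
    · rw [arrows_cons, ← List.append_assoc] at h
      obtain ⟨h₁, h₂⟩ := List.append_inj' h rfl
      obtain ⟨u, p₁, p₂, rfl, rfl, rfl⟩ := ih l h₁
      exact ⟨u, p₁, p₂.cons e, rfl, rfl, by rw [arrows_cons, h₂]⟩

theorem source_of_arrows {v w : Γ.QVertex} (p : Quiver.Path v w) (a : Γ.Arrow) (l : List Γ.Arrow)
    (h : arrows p = a :: l) : v = Γ.toQVertex (Γ.polyAt a.vertex a.pos) := by
  obtain ⟨u, p₁, -, -, h₁, -⟩ := Γ.exists_split p [a] l h
  cases p₁ with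
  | nil => simp at h₁
  | cons p₁ e =>
    cases p₁ with
    | nil =>
      obtain rfl : e.1 = a := by simpa using h₁
      exact e.2.1.symm
    | cons => simpa using congrArg List.length h₁

/-! ### Consecutive arrows -/

/-- The arrow at position `i` (modulo `val(α)`) of the successor sequence at `α`. -/
def arrow (α : Γ₀) (h : ¬ Γ.IsTruncated α) (i : ℕ) : Γ.Arrow :=
  ⟨α, h, ⟨i % Γ.val α, Nat.mod_lt _ (Γ.val_pos α)⟩⟩

@[simp]
theorem arrow_vertex (α : Γ₀) (h : ¬ Γ.IsTruncated α) (i : ℕ) : (Γ.arrow α h i).vertex = α := rfl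

theorem arrowAt_val (α : Γ₀) (h : ¬ Γ.IsTruncated α) (i : ℕ) :
    (Γ.arrowAt α h i).1 = Γ.arrow α h i := rfl

@[simp]
theorem arrow_self (a : Γ.Arrow) : Γ.arrow a.vertex a.nontruncated a.pos = a := by
  obtain ⟨α, h, i⟩ := a
  simp [arrow, Nat.mod_eq_of_lt i.2]

theorem arrow_add_val (α : Γ₀) (h : ¬ Γ.IsTruncated α) (i : ℕ) :
    Γ.arrow α h (i + Γ.val α) = Γ.arrow α h i := by
  simp [arrow]

theorem polyAt_mod (α : Γ₀) (i : ℕ) : Γ.polyAt α (i % Γ.val α) = Γ.polyAt α i := by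
  simp [polyAt]

theorem polyAt_congr (α : Γ₀) {i j : ℕ} (h : i ≡ j [MOD Γ.val α]) :
    Γ.polyAt α i = Γ.polyAt α j := by
  rw [← polyAt_mod, h, polyAt_mod]

theorem polyAt_mod_add (α : Γ₀) (i k : ℕ) :
    Γ.polyAt α (i % Γ.val α + k) = Γ.polyAt α (i + k) :=
  Γ.polyAt_congr α ((Nat.mod_modEq _ _).add_right k)

theorem polyAt_add_mul_val (α : Γ₀) (i j : ℕ) :
    Γ.polyAt α (i + j * Γ.val α) = Γ.polyAt α i :=
  Γ.polyAt_congr α (by simp [Nat.ModEq])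

variable {Γ} in
/-- The arrow that follows an arrow in its successor sequence. -/
def Arrow.succ (a : Γ.Arrow) : Γ.Arrow := Γ.arrow a.vertex a.nontruncated (a.pos + 1)

@[simp]
theorem succ_arrow (α : Γ₀) (h : ¬ Γ.IsTruncated α) (i : ℕ) :
    (Γ.arrow α h i).succ = Γ.arrow α h (i + 1) := by
  simp [Arrow.succ, arrow]

@[simp]
theorem succ_iterate_arrow (α : Γ₀) (h : ¬ Γ.IsTruncated α) (i n : ℕ) :
    Arrow.succ^[n] (Γ.arrow α h i) = Γ.arrow α h (i + n) := by
  induction n with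
  | zero => rfl
  | succ n ih => rw [Function.iterate_succ_apply', ih, succ_arrow, add_assoc]

@[simp]
theorem vertex_iterate_succ (a : Γ.Arrow) (n : ℕ) : (Arrow.succ^[n] a).vertex = a.vertex := by
  rw [← Γ.arrow_self a, succ_iterate_arrow]
  rfl

@[simp]
theorem arrows_walk (α : Γ₀) (h : ¬ Γ.IsTruncated α) (i k : ℕ) :
    arrows (Γ.walk α h i k) = List.iterate Arrow.succ (Γ.arrow α h i) k := by
  induction k with
  | zero => rfl
  | succ k ih =>
    rw [walk, arrows_cons, ih, List.iterate_add, arrowAt_val, succ_iterate_arrow]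
    rfl

@[simp]
theorem arrows_specialCycle (α : Γ₀) (h : ¬ Γ.IsTruncated α) (i : ℕ) :
    arrows (Γ.specialCycle α h i) = List.iterate Arrow.succ (Γ.arrow α h i) (Γ.val α) := by
  simp [specialCycle]

/-- A list of arrows is a chain if each arrow is the successor of the preceding one. -/
def IsSuccChain (l : List Γ.Arrow) : Prop := l.IsChain fun a b => b = a.succ

/-- Since the successor is a function, a chain is determined by its first arrow and its length. This
reduces surviving nontrivial paths to pairs (start, length). -/
theorem isSuccChain_cons_iff (a : Γ.Arrow) (l : List Γ.Arrow) :
    Γ.IsSuccChain (a :: l) ↔ a :: l = List.iterate Arrow.succ a (l.length + 1) := by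
  induction l generalizing a with
  | nil => simp [IsSuccChain, List.iterate]
  | cons b l ih =>
    rw [IsSuccChain, List.isChain_cons_cons, ← IsSuccChain, ih, List.length_cons,
      List.iterate.eq_def _ _ (l.length + 1 + 1)]
    simp only [List.cons.injEq, true_and]
    constructor
    · rintro ⟨rfl, h⟩
      exact h
    · intro h
      obtain rfl : b = a.succ := by
        rw [List.iterate] at h
        exact (List.cons.inj h).1
      exact ⟨rfl, h⟩

theorem isSuccChain_iterate (a : Γ.Arrow) (n : ℕ) :
    Γ.IsSuccChain (List.iterate Arrow.succ a n) := by
  cases n with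
  | zero => exact List.IsChain.nil
  | succ n =>
    rw [List.iterate, isSuccChain_cons_iff, List.length_iterate]
    rfl

theorem IsSuccChain.of_append {l₁ l₂ l₃ : List Γ.Arrow} (h : Γ.IsSuccChain (l₁ ++ l₂ ++ l₃)) :
    Γ.IsSuccChain l₂ :=
  List.IsChain.right_of_append (List.IsChain.left_of_append h)

theorem exists_not_succ (l : List Γ.Arrow) (h : ¬ Γ.IsSuccChain l) :
    ∃ l₁ a b l₂, b ≠ Arrow.succ a ∧ l = l₁ ++ [a, b] ++ l₂ := by
  contrapose! h
  rw [IsSuccChain, List.isChain_iff_forall_rel_of_append_cons_cons]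
  intro a b l₁ l₂ hl
  by_contra hab
  exact h l₁ a b l₂ hab (by simpa using hl)

/-! ### Normal forms -/

/-- The normal forms of nonzero paths in the Brauer configuration algebra: paths of length zero,
proper subpaths of the maximal paths, and one socle element for each polygon. -/
inductive NormalForm
  | nil (v : Γ.QVertex)
  | walk (a : Γ.Arrow) (k : ℕ)
  | soc (v : Γ.QVertex)

variable (K : Type*) [Field K]

open Classical in
/-- The normal form, or zero, of a path that is given by its source and the list of its arrows. -/
def normalize (v : Γ.QVertex) : List Γ.Arrow → (Γ.NormalForm →₀ K)
  | [] => Finsupp.single (.nil v) 1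
  | a :: l =>
    if Γ.IsSuccChain (a :: l) then
      if l.length + 1 < Γ.mult a.vertex * Γ.val a.vertex then
        Finsupp.single (.walk a (l.length + 1)) 1
      else if l.length + 1 = Γ.mult a.vertex * Γ.val a.vertex then Finsupp.single (.soc v) 1
      else 0
    else 0

theorem normalize_of_not_isSuccChain (v : Γ.QVertex) (l : List Γ.Arrow)
    (h : ¬ Γ.IsSuccChain l) : Γ.normalize K v l = 0 := by
  cases l with
  | nil => exact absurd List.IsChain.nil h
  | cons a l => simp [normalize, h]

theorem vertex_of_mem_isSuccChain {a b : Γ.Arrow} {l : List Γ.Arrow}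
    (h : Γ.IsSuccChain (a :: l)) (hb : b ∈ a :: l) : b.vertex = a.vertex := by
  rw [(Γ.isSuccChain_cons_iff a l).1 h, List.mem_iterate] at hb
  obtain ⟨m, -, rfl⟩ := hb
  simp

/-- A chain stays in the successor sequence of one vertex, so any of its arrows supplies the length
bound. Leaving `b` arbitrary allows an arrow of a special cycle in the middle of the word to be
used. -/
theorem normalize_of_lt (v : Γ.QVertex) (l : List Γ.Arrow) (b : Γ.Arrow) (hb : b ∈ l)
    (h : Γ.mult b.vertex * Γ.val b.vertex < l.length) : Γ.normalize K v l = 0 := by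
  cases l with
  | nil => simp at hb
  | cons a l =>
    by_cases hc : Γ.IsSuccChain (a :: l)
    · rw [Γ.vertex_of_mem_isSuccChain hc hb, List.length_cons] at h
      simp [normalize, h.not_gt, h.ne']
    · exact Γ.normalize_of_not_isSuccChain K v _ hc

theorem normalize_iterate_lt (v : Γ.QVertex) (a : Γ.Arrow) (k : ℕ) (hk : 0 < k)
    (h : k < Γ.mult a.vertex * Γ.val a.vertex) :
    Γ.normalize K v (List.iterate Arrow.succ a k) = Finsupp.single (.walk a k) 1 := by
  obtain ⟨k, rfl⟩ := Nat.exists_eq_add_one_of_ne_zero hk.ne'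
  have := Γ.isSuccChain_iterate a (k + 1)
  rw [List.iterate] at this ⊢
  simp [normalize, this, h]

theorem mult_mul_val_pos (α : Γ₀) : 0 < Γ.mult α * Γ.val α :=
  Nat.mul_pos (Γ.mult_pos α) (Γ.val_pos α)

theorem normalize_iterate_eq (v : Γ.QVertex) (a : Γ.Arrow) :
    Γ.normalize K v (List.iterate Arrow.succ a (Γ.mult a.vertex * Γ.val a.vertex)) =
      Finsupp.single (.soc v) 1 := by
  have hk := Γ.mult_mul_val_pos a.vertex
  obtain ⟨k, hk⟩ := Nat.exists_eq_add_one_of_ne_zero hk.ne'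
  have := Γ.isSuccChain_iterate a (k + 1)
  rw [hk]
  rw [List.iterate] at this ⊢
  simp [normalize, this, hk]

/-- The linear extension of the normal form of paths. -/
def normalForm : PathAlgebra K Γ.QVertex →ₗ[K] (Γ.NormalForm →₀ K) :=
  Finsupp.linearCombination K fun p : AnyPath Γ.QVertex => Γ.normalize K p.1 (arrows p.2.2)

@[simp]
theorem normalForm_ofPath {v w : Γ.QVertex} (p : Quiver.Path v w) :
    Γ.normalForm K (PathAlgebra.ofPath K p) = Γ.normalize K v (arrows p) := by
  unfold normalForm PathAlgebra.ofPath
  erw [Finsupp.linearCombination_single, one_smul]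

open Classical in
theorem normalForm_triple {a b c d e f : Γ.QVertex} (p : Quiver.Path a b) (r : Quiver.Path c d)
    (q : Quiver.Path e f) :
    Γ.normalForm K (PathAlgebra.ofPath K p * PathAlgebra.ofPath K r * PathAlgebra.ofPath K q) =
      if c = b ∧ e = d then Γ.normalize K a (arrows p ++ arrows r ++ arrows q) else 0 := by
  by_cases h₁ : c = b
  · subst h₁
    rw [PathAlgebra.ofPath_mul_comp]
    by_cases h₂ : e = d
    · subst h₂
      rw [PathAlgebra.ofPath_mul_comp]
      simp
    · simp [PathAlgebra.ofPath_mul_of_ne _ _ h₂, h₂]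
  · simp [PathAlgebra.ofPath_mul_of_ne _ _ h₁, h₁]

/-! ### Powers of special cycles -/

theorem exists_path_specialElt_pow (α : Γ₀) (h : ¬ Γ.IsTruncated α) (i j : ℕ) (hj : 0 < j) :
    ∃ p : Quiver.Path (Γ.toQVertex (Γ.polyAt α i)) (Γ.toQVertex (Γ.polyAt α i)),
      Γ.specialElt K α h i ^ j = PathAlgebra.ofPath K p ∧
      arrows p = List.iterate Arrow.succ (Γ.arrow α h i) (j * Γ.val α) := by
  induction j, hj using Nat.le_induction with
  | base => exact ⟨Γ.specialCycle α h i, pow_one _, by simp⟩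
  | succ j _ ih =>
    obtain ⟨p, hp, hp'⟩ := ih
    refine ⟨(Γ.specialCycle α h i).comp p, ?_, ?_⟩
    · rw [pow_succ', hp, specialElt, PathAlgebra.ofPath_mul_comp]
    · rw [arrows_comp, arrows_specialCycle, hp', add_mul, one_mul, add_comm, List.iterate_add,
        succ_iterate_arrow, arrow_add_val]

/-- A walk of length μ(α)·val(α) is maximal: any extension on either side is too long or not a
chain. The value does not depend on α or the position, which is why relations of type one cancel and
those of type two vanish. -/
theorem normalize_special (v : Γ.QVertex) (α : Γ₀) (h : ¬ Γ.IsTruncated α) (i : ℕ)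
    (l₁ l₂ : List Γ.Arrow) [Decidable (l₁ = [] ∧ l₂ = [])] :
    Γ.normalize K v
      (l₁ ++ List.iterate Arrow.succ (Γ.arrow α h i) (Γ.mult α * Γ.val α) ++ l₂) =
      if l₁ = [] ∧ l₂ = [] then Finsupp.single (.soc v) 1 else 0 := by
  split_ifs with hl
  · obtain ⟨rfl, rfl⟩ := hl
    simpa using Γ.normalize_iterate_eq K v (Γ.arrow α h i)
  · refine Γ.normalize_of_lt K v _ (Γ.arrow α h i) ?_ ?_
    · refine List.mem_append_left _ (List.mem_append_right _ (List.mem_iterate.2 ⟨0, ?_, rfl⟩))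
      exact Γ.mult_mul_val_pos α
    · have : 0 < l₁.length ∨ 0 < l₂.length := by
        simp only [List.length_pos_iff]
        tauto
      simp only [arrow_vertex, List.length_append, List.length_iterate]
      omega

theorem succ_ne_of_relationThree {u v w : Γ.QVertex} (a : u ⟶ v) (b : v ⟶ w)
    (h₁ : ∀ (α : Γ₀) (hα : ¬ Γ.IsTruncated α) (i : ℕ),
      ¬ (a.toPath.comp b.toPath).IsSubpath (Γ.specialCycle α hα i))
    (h₂ : ¬ (a.1 = b.1 ∧ Γ.val a.1.vertex = 1)) : b.1 ≠ a.1.succ := by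
  intro hab
  obtain ⟨α, hα, i, hi⟩ : ∃ α hα i, a.1 = Γ.arrow α hα i := ⟨_, _, _, (Γ.arrow_self a.1).symm⟩
  rw [hi] at hab h₂
  rw [hab] at h₂
  rw [succ_arrow] at hab h₂
  have hv := Γ.val_pos α
  rcases Nat.lt_or_ge 1 (Γ.val α) with hv | hv
  -- The special cycle at the position of `a` has length at least two, hence begins with `a`, `b`,
  -- against `h₁`.
  · obtain ⟨k, hk⟩ := Nat.exists_eq_add_of_le' (Nat.succ_le_of_lt hv)
    have hC : arrows (Γ.specialCycle α hα i) =
        [a.1, b.1] ++ List.iterate Arrow.succ (Γ.arrow α hα (i + 2)) k := by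
      simp [hk, List.iterate, hi, hab, add_assoc]
    obtain ⟨x, p₁, p₂, hp, hp₁, -⟩ := Γ.exists_split _ _ _ hC
    have hu : Γ.toQVertex (Γ.polyAt α i) = u := by
      rw [← a.2.1, hi]
      exact congrArg _ (Γ.polyAt_mod α i).symm
    subst hu
    have hp₁' : arrows p₁ = arrows (a.toPath.comp b.toPath) := by simpa using hp₁
    obtain rfl := Γ.target_eq _ _ rfl hp₁'
    refine h₁ α hα i ⟨.nil, p₂, ?_⟩
    rw [hp, Γ.path_ext hp₁', Quiver.Path.nil_comp]
  -- With valency one the arrow is a loop that is its own successor, which is the excepted case.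
  · exact h₂ ⟨by simp [arrow, Nat.mod_one, show Γ.val α = 1 by omega], by
      rw [arrow_vertex]; omega⟩

/-- Special cycles are successor chains and so are their subpaths, while the excepted loop is its
own successor; a pair that is not consecutive avoids both. -/
theorem relationThree_of_succ_ne {u v w : Γ.QVertex} (a : u ⟶ v) (b : v ⟶ w)
    (hab : b.1 ≠ a.1.succ) :
    PathAlgebra.ofPath K (a.toPath.comp b.toPath) ∈ Γ.relationsThree K := by
  refine ⟨u, v, w, a, b, ?_, ?_, rfl⟩
  · rintro α hα i ⟨r, s, hC⟩
    have h := Γ.isSuccChain_iterate (Γ.arrow α hα i) (Γ.val α)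
    rw [← arrows_specialCycle, hC, arrows_comp, arrows_comp] at h
    exact hab (by simpa [IsSuccChain] using h.of_append)
  · rintro ⟨h, hv⟩
    refine hab ?_
    rw [← h]
    generalize a.1 = a at hv
    obtain ⟨α, hα, i⟩ := a
    simp only at hv
    simp only [Arrow.succ, arrow, Arrow.mk.injEq, heq_eq_eq, true_and]
    exact Fin.ext (by have := i.2; simp only [hv, Nat.mod_one]; omega)

theorem normalForm_paths_of_relation {a b e f : Γ.QVertex} (p : Quiver.Path a b)
    (q : Quiver.Path e f) (r : PathAlgebra K Γ.QVertex)
    (hr : r ∈ Γ.relationsOne K ∪ Γ.relationsTwo K ∪ Γ.relationsThree K) :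
    Γ.normalForm K (PathAlgebra.ofPath K p * r * PathAlgebra.ofPath K q) = 0 := by
  classical
  rcases hr with (⟨α, β, hα, hβ, i, j, hij, rfl⟩ | ⟨α, hα, i, rfl⟩) | ⟨u, v, w, x, y, h₁, h₂, rfl⟩
  · obtain ⟨c, hc, hc'⟩ := Γ.exists_path_specialElt_pow K α hα i _ (Γ.mult_pos α)
    obtain ⟨d, hd, hd'⟩ := Γ.exists_path_specialElt_pow K β hβ j _ (Γ.mult_pos β)
    rw [hc, hd, mul_sub, sub_mul, map_sub, normalForm_triple, normalForm_triple, hc', hd', hij,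
      normalize_special, normalize_special, sub_self]
  · obtain ⟨c, hc, hc'⟩ := Γ.exists_path_specialElt_pow K α hα i _ (Γ.mult_pos α)
    rw [hc, PathAlgebra.ofPath_mul_comp, normalForm_triple, arrows_comp, hc', List.append_assoc,
      List.append_assoc, ← List.append_assoc, normalize_special]
    simp
  · rw [normalForm_triple, Γ.normalize_of_not_isSuccChain, ite_self]
    intro h
    refine Γ.succ_ne_of_relationThree x y h₁ h₂ ?_
    simpa [IsSuccChain] using h.of_append

theorem normalForm_mul_mul (r : PathAlgebra K Γ.QVertex)
    (hr : r ∈ Γ.relationsOne K ∪ Γ.relationsTwo K ∪ Γ.relationsThree K)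
    (x y : PathAlgebra K Γ.QVertex) : Γ.normalForm K (x * r * y) = 0 := by
  induction x using PathAlgebra.induction_on_paths with
  | zero => simp
  | add x x' hx hx' => simp [add_mul, hx, hx']
  | smul c p =>
    induction y using PathAlgebra.induction_on_paths with
    | zero => simp
    | add y y' hy hy' => rw [mul_add, map_add, hy, hy', add_zero]
    | smul d q =>
      rw [smul_mul_assoc, smul_mul_assoc, mul_smul_comm, map_smul, map_smul,
        Γ.normalForm_paths_of_relation K p q r hr, smul_zero, smul_zero]

theorem normalForm_of_mem (x : PathAlgebra K Γ.QVertex) (hx : x ∈ Γ.relationIdeal K) :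
    Γ.normalForm K x = 0 := by
  rw [relationIdeal, TwoSidedIdeal.mem_span_iff_mem_addSubgroup_closure] at hx
  induction hx using AddSubgroup.closure_induction with
  | mem x hx =>
    obtain ⟨_, ⟨x, -, r, hr, rfl⟩, y, -, rfl⟩ := hx
    exact Γ.normalForm_mul_mul K r hr x y
  | zero => simp
  | add x y _ _ hx hy => simp [hx, hy]
  | neg x _ hx => simp [hx]

/-! ### The normal form of an element of the algebra -/

theorem proj_surjective : Function.Surjective (Γ.proj K) := RingCon.mk'_surjective _

theorem proj_eq_iff (x y : PathAlgebra K Γ.QVertex) :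
    Γ.proj K x = Γ.proj K y ↔ x - y ∈ Γ.relationIdeal K := by
  rw [← TwoSidedIdeal.rel_iff]
  exact (Γ.relationIdeal K).ringCon.eq

theorem proj_smul (c : K) (x : PathAlgebra K Γ.QVertex) : Γ.proj K (c • x) = c • Γ.proj K x := rfl

theorem proj_relation {r : PathAlgebra K Γ.QVertex}
    (hr : r ∈ Γ.relationsOne K ∪ Γ.relationsTwo K ∪ Γ.relationsThree K) : Γ.proj K r = 0 := by
  rw [← map_zero (Γ.proj K), proj_eq_iff, sub_zero]
  exact TwoSidedIdeal.subset_span hr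

/-- The canonical surjection as a linear map. -/
def projLinear : PathAlgebra K Γ.QVertex →ₗ[K] Γ.Alg K where
  toFun := Γ.proj K
  map_add' := map_add _
  map_smul' := Γ.proj_smul K

theorem normalForm_eq_zero_of_proj {x : PathAlgebra K Γ.QVertex} (hx : Γ.proj K x = 0) :
    Γ.normalForm K x = 0 := by
  rw [← map_zero (Γ.proj K), proj_eq_iff, sub_zero] at hx
  exact Γ.normalForm_of_mem K x hx

/-- Elements of the path algebra with linearly independent normal forms have linearly independent
classes. -/
theorem linearIndependent_proj {ι : Type*} (x : ι → PathAlgebra K Γ.QVertex)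
    (h : LinearIndependent K fun i => Γ.normalForm K (x i)) :
    LinearIndependent K fun i => Γ.proj K (x i) := by
  rw [linearIndependent_iff] at h ⊢
  intro c hc
  refine h c ?_
  have h₁ : Γ.projLinear K (Finsupp.linearCombination K x c) = 0 := by
    rw [Finsupp.apply_linearCombination]
    exact hc
  have h₂ := Γ.normalForm_eq_zero_of_proj K h₁
  rwa [Finsupp.apply_linearCombination] at h₂

/-! ### Occurrences of a polygon in a successor sequence -/

-- By periodicity, a window of val(α) consecutive positions sees V equally often wherever it begins.
open Classical in
theorem count_polyAt (α : Γ₀) (V : Γ₁) (i : ℕ) :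
    Nat.count (fun d => Γ.polyAt α (i + d) = V) (Γ.val α) = Γ.occ α V := by
  have hs : Γ.succSeq α = (List.range (Γ.val α)).map (Γ.polyAt α) := by
    refine List.ext_getElem (by simp [length_succSeq]) fun n h₁ h₂ => ?_
    rw [length_succSeq] at h₁
    simp [polyAt, Nat.mod_eq_of_lt h₁]
  have h0 : Nat.count (fun d => Γ.polyAt α d = V) (Γ.val α) = Γ.occ α V := by
    rw [occ]
    convert Γ.count_succSeq α V
    rw [hs, List.count, List.countP_map]
    refine List.countP_congr fun d _ => ?_
    simp
  have hp : Function.Periodic (fun d => Γ.polyAt α d = V) (Γ.val α) := fun d => by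
    simp [polyAt_add_val]
  -- The count over the first i + val(α) positions is split both after i and after val(α); the
  -- pieces of length i agree by periodicity.
  have h₁ := Nat.count_add (fun d => Γ.polyAt α d = V) i (Γ.val α)
  have h₂ := Nat.count_add (fun d => Γ.polyAt α d = V) (Γ.val α) i
  have h₃ : Nat.count (fun k => Γ.polyAt α (Γ.val α + k) = V) i =
      Nat.count (fun d => Γ.polyAt α d = V) i := by
    simp_rw [add_comm (Γ.val α), polyAt_add_val]
  rw [add_comm (Γ.val α) i] at h₂
  omega

open Classical in
theorem count_polyAt_mul (α : Γ₀) (V : Γ₁) (i m : ℕ) :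
    Nat.count (fun d => Γ.polyAt α (i + d) = V) (m * Γ.val α) = m * Γ.occ α V := by
  induction m with
  | zero => simp
  | succ m ih =>
    rw [add_mul, one_mul, Nat.count_add, ih, add_mul, one_mul]
    simp_rw [← add_assoc]
    rw [count_polyAt]

theorem infinite_polyAt (α : Γ₀) (i : ℕ) :
    (Set.ofPred fun d => Γ.polyAt α (i + d) = Γ.polyAt α i).Infinite :=
  Set.infinite_of_injective_forall_mem (f := fun j => j * Γ.val α)
    (fun _ _ h => Nat.eq_of_mul_eq_mul_right (Γ.val_pos α) h) fun j => Γ.polyAt_add_mul_val α i j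

theorem gap_spec (α : Γ₀) (i : ℕ) :
    0 < Γ.gap α i ∧ Γ.polyAt α (i + Γ.gap α i) = Γ.polyAt α i :=
  Nat.sInf_mem (s := {d | 0 < d ∧ Γ.polyAt α (i + d) = Γ.polyAt α i})
    ⟨Γ.val α, Γ.val_pos α, Γ.polyAt_add_val α i⟩

/-- Iterated first returns enumerate all later visits in increasing order. The index of `Nat.nth`
starts at zero, and the zeroth visit is the offset 0 itself. -/
theorem next_iterate (α : Γ₀) (i k : ℕ) :
    (Γ.next α)^[k] i = i + Nat.nth (fun d => Γ.polyAt α (i + d) = Γ.polyAt α i) k := by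
  have hinf := Γ.infinite_polyAt α i
  induction k with
  | zero => simp [Nat.nth_zero_of_zero]
  | succ k ih =>
    have hk := Nat.nth_mem_of_infinite hinf k
    have hk' := Nat.nth_mem_of_infinite hinf (k + 1)
    have hlt := (Nat.nth_lt_nth hinf).2 (Nat.lt_succ_self k)
    rw [Function.iterate_succ_apply', ih, next]
    set n := Nat.nth (fun d => Γ.polyAt α (i + d) = Γ.polyAt α i) k
    set n' := Nat.nth (fun d => Γ.polyAt α (i + d) = Γ.polyAt α i) (k + 1) with hn'
    rw [add_assoc]
    congr 1
    obtain ⟨hg, hg'⟩ := Γ.gap_spec α (i + n)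
    refine le_antisymm ?_ ?_
    · have : Γ.gap α (i + n) ≤ n' - n := by
        refine Nat.sInf_le ⟨by omega, ?_⟩
        rw [hk, show i + n + (n' - n) = i + n' by omega, hk']
      omega
    · refine (Nat.isLeast_nth_of_infinite hinf (k + 1)).2 ⟨?_, fun j hj => ?_⟩
      · rw [← add_assoc, hg', hk]
      · have := (Nat.nth_le_nth hinf).2 (Nat.lt_succ_iff.1 hj)
        omega

/-! ### Classes of walks -/

/-- The image in the algebra of the walk of length `k` from position `i`. -/
def walkBar (α : Γ₀) (h : ¬ Γ.IsTruncated α) (i k : ℕ) : Γ.Alg K :=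
  Γ.proj K (PathAlgebra.ofPath K (Γ.walk α h i k))

theorem walkBar_eq {v w : Γ.QVertex} (p : Quiver.Path v w) (α : Γ₀) (h : ¬ Γ.IsTruncated α)
    (i k : ℕ) (hv : v = Γ.toQVertex (Γ.polyAt α i))
    (hp : arrows p = List.iterate Arrow.succ (Γ.arrow α h i) k) :
    Γ.proj K (PathAlgebra.ofPath K p) = Γ.walkBar K α h i k := by
  rw [walkBar, Γ.ofPath_congr K p (Γ.walk α h i k) hv (by rw [hp, arrows_walk])]

theorem walkBar_mul (α : Γ₀) (h : ¬ Γ.IsTruncated α) (i k l : ℕ) :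
    Γ.walkBar K α h i k * Γ.walkBar K α h (i + k) l = Γ.walkBar K α h i (k + l) := by
  rw [walkBar, walkBar, ← map_mul, PathAlgebra.ofPath_mul_comp]
  exact Γ.walkBar_eq K _ α h i _ rfl (by simp [List.iterate_add])

theorem walkBar_congr (α : Γ₀) (h : ¬ Γ.IsTruncated α) {i j : ℕ} (hij : i ≡ j [MOD Γ.val α])
    (k : ℕ) : Γ.walkBar K α h i k = Γ.walkBar K α h j k := by
  refine Γ.walkBar_eq K _ α h j k (congrArg _ (Γ.polyAt_congr α hij)) ?_
  rw [arrows_walk]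
  rw [arrow, arrow]
  congr 3

/-- The exponent zero is excluded because the empty power is the identity of the algebra, not the
idempotent of the starting polygon. -/
theorem specialBar_pow (α : Γ₀) (h : ¬ Γ.IsTruncated α) (i j : ℕ) (hj : 0 < j) :
    Γ.specialBar K α h i ^ j = Γ.walkBar K α h i (j * Γ.val α) := by
  obtain ⟨p, hp, hp'⟩ := Γ.exists_path_specialElt_pow K α h i j hj
  rw [specialBar, ← map_pow, hp]
  exact Γ.walkBar_eq K p α h i _ rfl hp'

theorem specialBar_pow_mul (α : Γ₀) (h : ¬ Γ.IsTruncated α) (i j k : ℕ) :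
    Γ.specialBar K α h i ^ j * Γ.walkBar K α h i k =
      Γ.walkBar K α h i (j * Γ.val α + k) := by
  rcases Nat.eq_zero_or_pos j with rfl | hj
  · simp
  · rw [specialBar_pow _ _ _ _ _ _ hj, ← walkBar_mul]
    congr 1
    exact Γ.walkBar_congr K α h (by simp [Nat.ModEq]) k

/-- Consecutive returns concatenate, so their lengths add up to the offset of the k-th visit. As for
powers, the empty product would be the identity rather than an idempotent. -/
theorem nonSpecialProd_eq (α : Γ₀) (h : ¬ Γ.IsTruncated α) (i k : ℕ) (hk : 0 < k) :
    Γ.nonSpecialProd K α h i k = Γ.walkBar K α h i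
      (Nat.nth (fun d => Γ.polyAt α (i + d) = Γ.polyAt α i) k) := by
  have hnext : ∀ k, Γ.gap α ((Γ.next α)^[k] i) +
      Nat.nth (fun d => Γ.polyAt α (i + d) = Γ.polyAt α i) k =
      Nat.nth (fun d => Γ.polyAt α (i + d) = Γ.polyAt α i) (k + 1) := by
    intro k
    have h₁ := Γ.next_iterate α i k
    have h₂ := Γ.next_iterate α i (k + 1)
    rw [Function.iterate_succ_apply', next] at h₂
    omega
  induction k, hk using Nat.le_induction with
  | base =>
    have := hnext 0
    rw [Nat.nth_zero_of_zero (by simp)] at this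
    simp only [nonSpecialProd, List.range_one, List.map_cons, List.map_nil, List.prod_cons,
      List.prod_nil, mul_one]
    rw [← this]
    rfl
  | succ k _ ih =>
    rw [nonSpecialProd, List.range_succ, List.map_append, List.prod_append, ← nonSpecialProd, ih,
      ← hnext, add_comm, ← walkBar_mul, ← next_iterate]
    simp
    rfl

theorem walkBar_mult_eq (α β : Γ₀) (hα : ¬ Γ.IsTruncated α) (hβ : ¬ Γ.IsTruncated β) (i j : ℕ)
    (hij : Γ.polyAt α i = Γ.polyAt β j) :
    Γ.walkBar K α hα i (Γ.mult α * Γ.val α) = Γ.specialBar K β hβ j ^ Γ.mult β := by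
  rw [← specialBar_pow _ _ _ _ _ _ (Γ.mult_pos α), ← sub_eq_zero, specialBar, specialBar,
    ← map_pow, ← map_pow, ← map_sub]
  exact Γ.proj_relation K (.inl (.inl ⟨α, β, hα, hβ, i, j, hij, rfl⟩))

/-- The relation C^μ f(C) is the walk of length μ(α)·val(α) + 1, and every longer walk from the same
position begins with it. -/
theorem walkBar_eq_zero (α : Γ₀) (hα : ¬ Γ.IsTruncated α) (i k : ℕ)
    (hk : Γ.mult α * Γ.val α < k) : Γ.walkBar K α hα i k = 0 := by
  have h₁ : Γ.walkBar K α hα i (Γ.mult α * Γ.val α + 1) = 0 := by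
    rw [← specialBar_pow_mul, ← Γ.proj_relation K (.inl (.inr ⟨α, hα, i, rfl⟩)), map_mul,
      map_pow]
    congr 1
  obtain ⟨l, rfl⟩ := Nat.exists_eq_add_of_lt hk
  rw [show Γ.mult α * Γ.val α + l + 1 = Γ.mult α * Γ.val α + 1 + l by ring, ← walkBar_mul, h₁,
    zero_mul]

theorem proj_eq_zero_of_not_isSuccChain {v w : Γ.QVertex} (p : Quiver.Path v w)
    (hp : ¬ Γ.IsSuccChain (arrows p)) : Γ.proj K (PathAlgebra.ofPath K p) = 0 := by
  obtain ⟨l₁, a, b, l₂, hab, hl⟩ := Γ.exists_not_succ _ hp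
  obtain ⟨u, q, p₂, rfl, hq, -⟩ := Γ.exists_split p _ _ hl
  rw [← List.singleton_append, ← List.append_assoc] at hq
  cases q with
  | nil => simp at hq
  | cons q e =>
    cases q with
    | nil => simpa using congrArg List.length hq
    | cons q f =>
      obtain ⟨h₁, h₂⟩ := List.append_inj' hq rfl
      obtain ⟨-, h₃⟩ := List.append_inj' h₁ rfl
      obtain rfl : e.1 = b := by simpa using h₂
      obtain rfl : f.1 = a := by simpa using h₃
      have : (q.cons f).cons e = q.comp (f.toPath.comp e.toPath) := rfl
      rw [this, ← PathAlgebra.ofPath_mul_comp, ← PathAlgebra.ofPath_mul_comp, map_mul, map_mul,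
        Γ.proj_relation K (.inr (Γ.relationThree_of_succ_ne K f e hab)), mul_zero, zero_mul]

/-! ### The basis elements as classes of walks -/

/-- Write the length as j·val(α) + r with r < val(α). If r = 0 the walk is a power of a special
cycle; otherwise the last r steps are a product of as many q's as there are returns to V, and μ(α)
decides between the second and third families. -/
theorem mem_basis_iff (V : Γ₁) (x : Γ.Alg K) :
    x ∈ Γ.basisOne K V ∪ Γ.basisTwo K V ∪ Γ.basisThree K V ↔
      ∃ (α : Γ₀) (h : ¬ Γ.IsTruncated α) (i k : ℕ), Γ.polyAt α i = V ∧ 0 < k ∧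
        k < Γ.mult α * Γ.val α ∧ Γ.polyAt α (i + k) = V ∧ x = Γ.walkBar K α h i k := by
  classical
  -- One full turn contains occ(α,V) visits including the one at offset 0, so the k-th return for k
  -- < occ(α,V) comes before the turn is complete.
  have nth_spec : ∀ (α : Γ₀) (i k : ℕ), Γ.polyAt α i = V → 1 ≤ k → k ≤ Γ.occ α V - 1 →
      0 < Nat.nth (fun d => Γ.polyAt α (i + d) = Γ.polyAt α i) k ∧
      Nat.nth (fun d => Γ.polyAt α (i + d) = Γ.polyAt α i) k < Γ.val α ∧
      Γ.polyAt α (i + Nat.nth (fun d => Γ.polyAt α (i + d) = Γ.polyAt α i) k) =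
        Γ.polyAt α i := by
    rintro α i k rfl h₁ h₂
    refine ⟨?_, ?_, Nat.nth_mem_of_infinite (Γ.infinite_polyAt α i) k⟩
    · exact lt_of_le_of_lt (Nat.zero_le _) ((Nat.nth_lt_nth (Γ.infinite_polyAt α i)).2 h₁)
    · refine Nat.nth_lt_of_lt_count ?_
      rw [count_polyAt]
      omega
  constructor
  · rintro ((⟨α, h, i, j, hm, hi, hj, hj', rfl⟩ | ⟨α, h, i, j, k, hv, hm, ho, hi, hj, hk, hk', rfl⟩) |
      ⟨α, h, i, k, hv, hm, ho, hi, hk, hk', rfl⟩)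
    · refine ⟨α, h, i, j * Γ.val α, hi, Nat.mul_pos hj (Γ.val_pos α), ?_, ?_, ?_⟩
      · exact Nat.mul_lt_mul_of_pos_right (by omega) (Γ.val_pos α)
      · rw [polyAt_add_mul_val, hi]
      · exact Γ.specialBar_pow K α h i j hj
    · obtain ⟨h₁, h₂, h₃⟩ := nth_spec α i k hi hk hk'
      have hm' : (j + 1) * Γ.val α ≤ Γ.mult α * Γ.val α := Nat.mul_le_mul_right _ (by omega)
      rw [add_mul] at hm'
      refine ⟨α, h, i,
        j * Γ.val α + Nat.nth (fun d => Γ.polyAt α (i + d) = Γ.polyAt α i) k, hi, by omega, by omega, ?_, ?_⟩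
      · rw [add_left_comm, add_comm, polyAt_add_mul_val, h₃, hi]
      · rw [nonSpecialProd_eq _ _ _ _ _ _ hk, specialBar_pow_mul]
    · obtain ⟨h₁, h₂, h₃⟩ := nth_spec α i k hi hk hk'
      exact ⟨α, h, i, _, hi, h₁, by rw [hm]; omega, h₃.trans hi,
        Γ.nonSpecialProd_eq K α h i k hk⟩
  · rintro ⟨α, h, i, k, rfl, hk, hk', hik, rfl⟩
    have hv := Γ.val_pos α
    obtain ⟨j, r, hr, rfl⟩ : ∃ j r, r < Γ.val α ∧ k = j * Γ.val α + r :=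
      ⟨k / Γ.val α, k % Γ.val α, Nat.mod_lt _ hv, by rw [mul_comm, Nat.div_add_mod]⟩
    have hj : j < Γ.mult α := by
      by_contra hj
      have := Nat.mul_le_mul_right (Γ.val α) (not_lt.1 hj)
      omega
    rw [add_comm (j * _), ← add_assoc, polyAt_add_mul_val] at hik
    rcases Nat.eq_zero_or_pos r with rfl | hr₀
    · have hj₀ : 0 < j := by
        rcases Nat.eq_zero_or_pos j with rfl | hj₀
        · simp at hk
        · exact hj₀
      exact .inl (.inl ⟨α, h, i, j, by omega, rfl, hj₀, by omega,
        (Γ.specialBar_pow K α h i j hj₀).symm⟩)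
    -- The number k of factors is the number of visits at offsets below r. The visit at 0 makes it
    -- positive; the visit at r itself is not counted, which keeps it below occ(α,V).
    · have hc₁ := Nat.count_strict_mono (p := fun d => Γ.polyAt α (i + d) = Γ.polyAt α i) rfl hr₀
      have hc₂ := Nat.count_strict_mono (p := fun d => Γ.polyAt α (i + d) = Γ.polyAt α i) hik hr
      have hc₃ := Nat.nth_count (p := fun d => Γ.polyAt α (i + d) = Γ.polyAt α i) hik
      rw [count_polyAt] at hc₂
      rw [Nat.count_zero] at hc₁
      have hw := Γ.nonSpecialProd_eq K α h i _ hc₁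
      rw [hc₃] at hw
      rcases Nat.lt_or_ge 1 (Γ.mult α) with hm | hm
      · refine .inl (.inr ⟨α, h, i, j, _, by omega, hm, by omega, rfl, by omega, hc₁, by omega, ?_⟩)
        rw [hw, specialBar_pow_mul]
      · obtain rfl : j = 0 := by omega
        refine .inr ⟨α, h, i, _, by omega, by omega, by omega, rfl, hc₁, by omega, ?_⟩
        rw [hw, zero_mul, zero_add]

/-! ### The basis as a family -/

/-- The occurrences `i` of `V` in the successor sequences at the nontruncated vertices, together
with the lengths `k` of the proper subwalks of the maximal walk that lead from there to `V`. -/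
def ClosedWalk (V : Γ₁) : Type _ :=
  Σ α : {α : Γ₀ // ¬ Γ.IsTruncated α}, Σ i : {i : Fin (Γ.val α.1) // Γ.polyAt α.1 i = V},
    {k : ℕ // 0 < k ∧ k < Γ.mult α.1 * Γ.val α.1 ∧ Γ.polyAt α.1 (i.1 + k) = V}

/-- The elements of the path algebra whose classes form the basis: the idempotent at `V`, the element
`c`, and the closed walks at `V`. -/
def basisLift (V : Γ₁) (c : PathAlgebra K Γ.QVertex) :
    Option (Option (Γ.ClosedWalk V)) → PathAlgebra K Γ.QVertex
  | none => PathAlgebra.ofPath K (Quiver.Path.nil : Quiver.Path (Γ.toQVertex V) (Γ.toQVertex V))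
  | some none => c
  | some (some ⟨α, i, k⟩) => PathAlgebra.ofPath K (Γ.walk α.1 α.2 i.1 k.1)

/-- The normal forms of the elements of the basis. -/
def basisNormalForm (V : Γ₁) : Option (Option (Γ.ClosedWalk V)) → Γ.NormalForm
  | none => .nil V
  | some none => .soc V
  | some (some ⟨α, i, k⟩) => .walk ⟨α.1, α.2, i.1⟩ k.1

theorem basisNormalForm_injective (V : Γ₁) : Function.Injective (Γ.basisNormalForm V) := by
  rintro (_ | _ | ⟨⟨α, hα⟩, ⟨i, hi⟩, k, hk⟩) (_ | _ | ⟨⟨β, hβ⟩, ⟨j, hj⟩, l, hl⟩) h <;>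
    simp only [basisNormalForm, NormalForm.walk.injEq, Arrow.mk.injEq, reduceCtorEq] at h ⊢
  obtain ⟨⟨rfl, h₁⟩, rfl⟩ := h
  cases h₁
  rfl

theorem normalForm_basisLift (V : Γ₁) (α : Γ₀) (h : ¬ Γ.IsTruncated α) (i : ℕ)
    (hi : Γ.polyAt α i = V) (x : Option (Option (Γ.ClosedWalk V))) :
    Γ.normalForm K (Γ.basisLift K V (Γ.specialElt K α h i ^ Γ.mult α) x) =
      Finsupp.single (Γ.basisNormalForm V x) 1 := by
  subst hi
  rcases x with _ | _ | ⟨⟨β, hβ⟩, ⟨j, hj⟩, k, hk, hk', -⟩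
  · exact Γ.normalForm_ofPath K _
  · obtain ⟨p, hp, hp'⟩ := Γ.exists_path_specialElt_pow K α h i _ (Γ.mult_pos α)
    rw [basisLift, hp, normalForm_ofPath, hp']
    exact Γ.normalize_iterate_eq K _ (Γ.arrow α h i)
  · rw [basisLift, normalForm_ofPath, arrows_walk]
    refine (Γ.normalize_iterate_lt K _ (Γ.arrow β hβ j) k hk hk').trans ?_
    have := Γ.arrow_self ⟨β, hβ, j⟩
    simp only at this
    rw [this]
    rfl

theorem linearIndependent_basis (V : Γ₁) (α : Γ₀) (h : ¬ Γ.IsTruncated α) (i : ℕ)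
    (hi : Γ.polyAt α i = V) :
    LinearIndependent K fun x =>
      Γ.proj K (Γ.basisLift K V (Γ.specialElt K α h i ^ Γ.mult α) x) := by
  refine Γ.linearIndependent_proj K _ ?_
  simp_rw [Γ.normalForm_basisLift K V α h i hi]
  exact (Finsupp.linearIndependent_single_one K Γ.NormalForm).comp _
    (Γ.basisNormalForm_injective V)

theorem range_basisLift (V : Γ₁) (c : PathAlgebra K Γ.QVertex) :
    Set.range (fun x => Γ.proj K (Γ.basisLift K V c x)) = Γ.basisSet K V (Γ.proj K c) := by
  ext x
  rw [basisSet, Set.mem_union, mem_basis_iff]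
  constructor
  · rintro ⟨_ | _ | ⟨⟨β, hβ⟩, ⟨j, hj⟩, k, hk, hk', hk''⟩, rfl⟩
    · exact .inr (.inl rfl)
    · exact .inr (.inr rfl)
    · exact .inl ⟨β, hβ, j, k, hj, hk, hk', hk'', rfl⟩
  · rintro (⟨β, hβ, j, k, hj, hk, hk', hk'', rfl⟩ | rfl | rfl)
    · refine ⟨some (some ⟨⟨β, hβ⟩, ⟨⟨j % Γ.val β, Nat.mod_lt _ (Γ.val_pos β)⟩, ?_⟩, k, hk, hk', ?_⟩),
        ?_⟩
      · rw [polyAt_mod, hj]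
      · rw [polyAt_mod_add, hk'']
      · exact Γ.walkBar_congr K β hβ (Nat.mod_modEq _ _) k
    · exact ⟨none, rfl⟩
    · exact ⟨some none, rfl⟩

/-! ### The corner is spanned by the basis -/

theorem proj_mem_corner {V : Γ₁} {v w : Γ.QVertex} (p : Quiver.Path v w)
    (hv : v = Γ.toQVertex V) (hw : w = Γ.toQVertex V) :
    Γ.proj K (PathAlgebra.ofPath K p) ∈ Γ.corner K V := by
  refine ⟨Γ.proj K (PathAlgebra.ofPath K p), ?_⟩
  simp only [LinearMap.comp_apply, LinearMap.mulLeft_apply, LinearMap.mulRight_apply, idem]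
  generalize Γ.toQVertex V = u at hv hw
  subst hv hw
  rw [← map_mul, ← map_mul, PathAlgebra.ofPath_mul_comp, PathAlgebra.ofPath_mul_comp]
  simp

theorem corner_le_of_paths (V : Γ₁) (S : Submodule K (Γ.Alg K))
    (h : ∀ p : Quiver.Path (Γ.toQVertex V) (Γ.toQVertex V),
      Γ.proj K (PathAlgebra.ofPath K p) ∈ S) : Γ.corner K V ≤ S := by
  rintro _ ⟨x, rfl⟩
  obtain ⟨x, rfl⟩ := Γ.proj_surjective K x
  simp only [LinearMap.comp_apply, LinearMap.mulLeft_apply, LinearMap.mulRight_apply, idem]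
  rw [← map_mul, ← map_mul]
  generalize Γ.toQVertex V = u at h ⊢
  induction x using PathAlgebra.induction_on_paths with
  | zero => simp
  | add x y hx hy =>
    rw [add_mul, mul_add, map_add]
    exact S.add_mem hx hy
  | @smul c a b p =>
    rw [smul_mul_assoc, mul_smul_comm, proj_smul]
    refine S.smul_mem c ?_
    by_cases hb : u = b
    · subst hb
      rw [PathAlgebra.ofPath_mul_comp]
      by_cases ha : a = u
      · subst ha
        rw [PathAlgebra.ofPath_mul_comp]
        exact h _
      · rw [PathAlgebra.ofPath_mul_of_ne _ _ ha, map_zero]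
        exact S.zero_mem
    · rw [PathAlgebra.ofPath_mul_of_ne _ _ hb, mul_zero, map_zero]
      exact S.zero_mem

/-- A path with nonzero class is trivial or a walk along one successor sequence. Comparing its
length with μ·val gives a closed walk of the families, the socle element, or a contradiction. -/
theorem proj_path_mem_basisSet (V : Γ₁) (α : Γ₀) (h : ¬ Γ.IsTruncated α) (i : ℕ)
    (hi : Γ.polyAt α i = V) (p : Quiver.Path (Γ.toQVertex V) (Γ.toQVertex V))
    (hp : Γ.proj K (PathAlgebra.ofPath K p) ≠ 0) :
    Γ.proj K (PathAlgebra.ofPath K p) ∈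
      Γ.basisSet K V (Γ.specialBar K α h i ^ Γ.mult α) := by
  cases hl : arrows p with
  | nil =>
    rw [Γ.ofPath_congr K p .nil rfl hl]
    exact .inr (.inl rfl)
  | cons a l =>
    have hc : Γ.IsSuccChain (arrows p) := by
      by_contra hc
      exact hp (Γ.proj_eq_zero_of_not_isSuccChain K p hc)
    rw [hl, isSuccChain_cons_iff] at hc
    rw [← hl] at hc
    obtain ⟨β, hβ, j⟩ := a
    have hj := Γ.source_of_arrows p _ _ hl
    have ha := Γ.arrow_self ⟨β, hβ, j⟩
    simp only at hj ha
    rw [← ha] at hc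
    have hw := Γ.target_eq p (Γ.walk β hβ j (l.length + 1)) hj (by rw [hc, arrows_walk])
    rw [Γ.walkBar_eq K p β hβ j _ hj hc] at hp ⊢
    rcases lt_trichotomy (l.length + 1) (Γ.mult β * Γ.val β) with hk | hk | hk
    · exact .inl ((Γ.mem_basis_iff K V _).2
        ⟨β, hβ, j, _, hj.symm, Nat.succ_pos _, hk, hw.symm, rfl⟩)
    · rw [hk, Γ.walkBar_mult_eq K β α hβ h j i (hj.symm.trans hi.symm)]
      exact .inr (.inr rfl)
    · exact absurd (Γ.walkBar_eq_zero K β hβ j _ hk) hp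

theorem span_basisSet (V : Γ₁) (α : Γ₀) (h : ¬ Γ.IsTruncated α) (i : ℕ)
    (hi : Γ.polyAt α i = V) :
    Submodule.span K (Γ.basisSet K V (Γ.specialBar K α h i ^ Γ.mult α)) = Γ.corner K V := by
  refine le_antisymm (Submodule.span_le.2 ?_) (Γ.corner_le_of_paths K V _ fun p => ?_)
  · rintro x (hx | rfl | rfl)
    · rw [mem_basis_iff] at hx
      obtain ⟨β, hβ, j, k, hj, -, -, hk, rfl⟩ := hx
      exact Γ.proj_mem_corner K _ (congrArg _ hj) (congrArg _ hk)
    · exact Γ.proj_mem_corner K _ rfl rfl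
    · rw [specialBar_pow _ _ _ _ _ _ (Γ.mult_pos α)]
      exact Γ.proj_mem_corner K _ (congrArg _ hi)
        (congrArg _ ((Γ.polyAt_add_mul_val α i _).trans hi))
  · by_cases hp : Γ.proj K (PathAlgebra.ofPath K p) = 0
    · rw [hp]
      exact Submodule.zero_mem _
    · exact Submodule.subset_span (Γ.proj_path_mem_basisSet K V α h i hi p hp)

/-! ### The dimension -/

theorem finite_lengths (V : Γ₁) (α : Γ₀) (i : ℕ) :
    Finite {k : ℕ // 0 < k ∧ k < Γ.mult α * Γ.val α ∧ Γ.polyAt α (i + k) = V} :=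
  Set.Finite.subset (Set.finite_Iio (Γ.mult α * Γ.val α)) fun _ hk => hk.2.1

/-- The window of μ(α) full turns contains μ(α)·occ(α,V) visits to V; the added one is the visit at
offset 0, which is not an admissible length. -/
theorem card_lengths (V : Γ₁) (α : Γ₀) (i : ℕ) (hi : Γ.polyAt α i = V) :
    Nat.card {k : ℕ // 0 < k ∧ k < Γ.mult α * Γ.val α ∧ Γ.polyAt α (i + k) = V} + 1 =
      Γ.mult α * Γ.occ α V := by
  classical
  have hpos := Γ.mult_mul_val_pos α
  rw [← Γ.count_polyAt_mul α V i, Nat.count_eq_card_filter_range]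
  rw [← Finset.card_erase_add_one (a := 0) (by simpa [hi] using hpos)]
  congr 1
  rw [← Nat.card_eq_finsetCard]
  refine Nat.card_congr (Equiv.subtypeEquivRight fun k => ?_)
  simp [Nat.pos_iff_ne_zero]

theorem card_positions (V : Γ₁) (α : Γ₀) :
    Nat.card {i : Fin (Γ.val α) // Γ.polyAt α i = V} = Γ.occ α V := by
  classical
  rw [← Γ.count_polyAt α V 0]
  simp only [zero_add]
  rw [Nat.count_eq_card_filter_range, ← Nat.card_eq_finsetCard]
  refine Nat.card_congr ⟨fun i => ⟨i.1, ?_⟩, fun i => ⟨⟨i.1, ?_⟩, ?_⟩, fun _ => rfl, fun _ => rfl⟩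
  · simpa using i.2
  · exact Finset.mem_range.1 (Finset.mem_filter.1 i.2).1
  · exact (Finset.mem_filter.1 i.2).2

theorem occ_le_val (α : Γ₀) (V : Γ₁) : Γ.occ α V ≤ Γ.val α :=
  Finset.single_le_sum (f := fun V => Γ.occ α V) (fun _ _ => Nat.zero_le _) (Finset.mem_univ V)

theorem exists_polyAt_of_mem {α : Γ₀} {V : Γ₁} (h : α ∈ Γ.polygon V) :
    ∃ i, Γ.polyAt α i = V := by
  classical
  have h₁ : Γ.occ α V ≠ 0 := by simpa [occ] using h
  rw [← Γ.count_polyAt α V 0, Nat.count_ne_iff_exists] at h₁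
  obtain ⟨i, -, hi⟩ := h₁
  exact ⟨_, hi⟩

/-- This supplies a socle element for the finiteness and dimension claims, which mention no special
cycle. -/
theorem exists_special (V : Γ₁) :
    ∃ (α : Γ₀) (_ : ¬ Γ.IsTruncated α) (i : ℕ), Γ.polyAt α i = V := by
  classical
  obtain ⟨α, hα, h⟩ := Γ.exists_nontruncated V
  obtain ⟨i, hi⟩ := Γ.exists_polyAt_of_mem hα
  refine ⟨α, fun ht => ?_, i, hi⟩
  rw [IsTruncated, mul_comm] at ht
  refine h.ne' ?_
  rw [← ht, val]
  unfold occ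
  congr!

instance [Finite Γ₀] (V : Γ₁) : Finite (Γ.ClosedWalk V) := by
  have := Γ.finite_lengths V
  unfold ClosedWalk
  infer_instance

open Classical in
theorem card_closedWalk [Finite Γ₀] (V : Γ₁) :
    (Nat.card (Γ.ClosedWalk V) : ℤ) = ∑ α ∈ (Γ.polygon V).toFinset,
      (Γ.occ α V : ℤ) * ((Γ.occ α V : ℤ) * (Γ.mult α : ℤ) - 1) := by
  have := Fintype.ofFinite Γ₀
  have := Γ.finite_lengths V
  have h₁ : ∀ α : {α : Γ₀ // ¬ Γ.IsTruncated α},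
      (Nat.card (Σ i : {i : Fin (Γ.val α.1) // Γ.polyAt α.1 i = V},
        {k : ℕ // 0 < k ∧ k < Γ.mult α.1 * Γ.val α.1 ∧ Γ.polyAt α.1 (i.1 + k) = V}) : ℤ) =
      (Γ.occ α V : ℤ) * ((Γ.occ α V : ℤ) * (Γ.mult α : ℤ) - 1) := by
    intro α
    rw [Nat.card_sigma, Nat.cast_sum, Finset.sum_congr rfl (g := fun _ =>
      ((Γ.occ α V : ℤ) * (Γ.mult α : ℤ) - 1)), Finset.sum_const, Finset.card_univ,
      ← Nat.card_eq_fintype_card, card_positions, nsmul_eq_mul]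
    rintro ⟨i, hi⟩ -
    have := Γ.card_lengths V α i hi
    rw [eq_sub_iff_add_eq, mul_comm (Γ.occ α V : ℤ)]
    exact_mod_cast this
  have h₂ : Nat.card (Γ.ClosedWalk V) = _ := Nat.card_sigma
  rw [h₂, Nat.cast_sum, Finset.sum_congr rfl fun α _ => h₁ α,
    ← Finset.sum_subtype (Finset.univ.filter fun α => ¬ Γ.IsTruncated α) (by simp) fun α =>
      (Γ.occ α V : ℤ) * ((Γ.occ α V : ℤ) * (Γ.mult α : ℤ) - 1),
    Finset.sum_filter_of_ne, Finset.sum_subset (Finset.subset_univ (Γ.polygon V).toFinset)]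
  · intro α _ hα
    have : Γ.occ α V = 0 := by simpa [occ] using hα
    simp [this]
  -- A truncated vertex has μ = val = 1, so occ is 0 or 1 and its term in the dimension formula is
  -- zero.
  · intro α _ hα ht
    obtain ⟨hm, hv⟩ := mul_eq_one.1 ht
    refine hα ?_
    have hle := Γ.occ_le_val α V
    rw [hv] at hle
    interval_cases Γ.occ α V <;> simp [hm]

end

end BrauerConfiguration

open Classical in
theorem mainTheorem3 {K Γ₀ Γ₁ : Type*} [Field K] [Finite Γ₀] [Fintype Γ₁]
    (Γ : BrauerConfiguration Γ₀ Γ₁) (V : Γ₁) :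
    Module.Finite K (Γ.corner K V) ∧
    (Module.finrank K (Γ.corner K V) : ℤ) =
      2 + ∑ α ∈ (Γ.polygon V).toFinset,
        (Γ.occ α V : ℤ) * ((Γ.occ α V : ℤ) * (Γ.mult α : ℤ) - 1) ∧
    ∀ (α : Γ₀) (h : ¬ Γ.IsTruncated α) (i : ℕ), Γ.polyAt α i = V →
      LinearIndepOn K id (Γ.basisSet K V (Γ.specialBar K α h i ^ Γ.mult α)) ∧
      Submodule.span K (Γ.basisSet K V (Γ.specialBar K α h i ^ Γ.mult α)) = Γ.corner K V := by
  have hrange : ∀ (α : Γ₀) (h : ¬ Γ.IsTruncated α) (i : ℕ),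
      Γ.basisSet K V (Γ.specialBar K α h i ^ Γ.mult α) =
        Set.range fun x => Γ.proj K (Γ.basisLift K V (Γ.specialElt K α h i ^ Γ.mult α) x) :=
    fun α h i => by
      rw [Γ.range_basisLift, map_pow, BrauerConfiguration.specialBar]
  obtain ⟨α, h, i, hi⟩ := Γ.exists_special V
  have := Fintype.ofFinite (Γ.ClosedWalk V)
  refine ⟨?_, ?_, fun β h' j hj => ⟨?_, Γ.span_basisSet K V β h' j hj⟩⟩
  · rw [← Γ.span_basisSet K V α h i hi, hrange]
    exact Module.Finite.span_of_finite K (Set.finite_range _)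
  -- The two `Option` layers, for the idempotent and the socle element, give the summand 2.
  · rw [← Γ.card_closedWalk V, ← Γ.span_basisSet K V α h i hi, hrange,
      finrank_span_eq_card (Γ.linearIndependent_basis K V α h i hi), Fintype.card_option,
      Fintype.card_option, Nat.card_eq_fintype_card]
    push_cast
    ring
  · rw [hrange]
    exact (Γ.linearIndependent_basis K V β h' j hj).linearIndepOn_id
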